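/- Let $G$ be a group in which every element has only finitely many conjugates (an FC-group), and suppose that the natural action of $\mathrm{Aut}(G)$ on $G$ has only finitely many orbits. Then the derived subgroup $G'$ is finite. Moreover, the set $\mathrm{Tor}(G)$ of all elements of finite order of $G$ is a subgroup, and there is a divisible subgroup $D$ of the centre $Z(G)$ such that $D$ is characteristic in $Z(G)$ and $G$ is the internal direct product $G = \mathrm{Tor}(G) \times D$. -/

import Mathlib

/-- A group `G` is an FC-group if every element of `G` has only finitely many conjugates. -/
def IsFCGroup (G : Type*) [Group G] : Prop :=
  ∀ g : G, {x : G | IsConj g x}.Finite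

/-- `G` has finitely many automorphism orbits: the natural action of `Aut(G)` on `G`
has finitely many orbits. -/
def HasFinitelyManyAutOrbits (G : Type*) [Group G] : Prop :=
  Finite (MulAction.orbitRel.Quotient (MulAut G) G)

/-- A (multiplicative) group is divisible if each element has an `n`-th root for every
positive integer `n`. -/
def IsDivisibleGroup (A : Type*) [Group A] : Prop :=
  ∀ n : ℕ, 0 < n → ∀ a : A, ∃ b : A, b ^ n = a

/-- `G` is the internal direct product of its subgroups `H` and `K`. -/
structure IsInternalDirectProduct {G : Type*} [Group G] (H K : Subgroup G) : Prop where
  normal_left : H.Normal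
  normal_right : K.Normal
  inf_eq_bot : H ⊓ K = ⊥
  sup_eq_top : H ⊔ K = ⊤

/-! Finitely many orbits make bounds that exist for each element uniform. So class sizes are bounded
and Neumann's argument makes `G'` finite, whence torsion is closed under products; some power `g ^
m` is always central; torsion has bounded exponent `e`; and for some `N` the group `D` of `N`-th
powers in the centre is divisible. Divisibility against the exponent `e` makes `D` torsion-free, and
dividing `g` by a root in `D` of `g ^ (m * N)` leaves a torsion element. -/

section ConjugacyClasses

open scoped commutatorElement

variable {G : Type*} [Group G]

theorem finiteIndex_centralizer_of_finite_conj {g : G} (h : {x : G | IsConj g x}.Finite) :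
    (Subgroup.centralizer ({g} : Set G)).FiniteIndex := by
  have := h.to_subtype
  let f : G ⧸ Subgroup.centralizer ({g} : Set G) → {x : G | IsConj g x} :=
    fun q => ⟨q.out * g * q.out⁻¹, isConj_iff.2 ⟨q.out, rfl⟩⟩
  have hf : Function.Injective f := by
    intro p q hpq
    have hpq : p.out * g * p.out⁻¹ = q.out * g * q.out⁻¹ := congrArg Subtype.val hpq
    rw [← QuotientGroup.out_eq' p, ← QuotientGroup.out_eq' q, QuotientGroup.eq,
      Subgroup.mem_centralizer_singleton_iff]
    have : q.out⁻¹ * (p.out * g * p.out⁻¹) * p.out = q.out⁻¹ * (q.out * g * q.out⁻¹) * p.out := by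
      rw [hpq]
    have h2 : q.out⁻¹ * p.out * g = g * (q.out⁻¹ * p.out) := by
      simpa [mul_assoc] using this
    calc p.out⁻¹ * q.out * g
        = (p.out⁻¹ * q.out) * (g * (q.out⁻¹ * p.out)) * (p.out⁻¹ * q.out) := by group
      _ = g * (p.out⁻¹ * q.out) := by rw [← h2]; group
  have := Finite.of_injective f hf
  exact Subgroup.finiteIndex_of_finite_quotient

/-- B. H. Neumann: a group with boundedly finite conjugacy classes has finitely many
commutators. -/
theorem finite_commutatorSet_of_bounded_conj (hfin : ∀ g : G, {x : G | IsConj g x}.Finite)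
    (N : ℕ) (hN : ∀ g : G, {x : G | IsConj g x}.ncard ≤ N) : (commutatorSet G).Finite := by
  obtain ⟨a, ha⟩ : ∃ a : G, ∀ g : G, {x | IsConj g x}.ncard ≤ {x | IsConj a x}.ncard := by
    have hbdd : BddAbove (Set.range fun g : G => {x | IsConj g x}.ncard) :=
      ⟨N, by rintro _ ⟨g, rfl⟩; exact hN g⟩
    obtain ⟨a, ha⟩ := Nat.sSup_mem (Set.range_nonempty _) hbdd
    exact ⟨a, fun g => (le_csSup hbdd ⟨g, rfl⟩).trans_eq ha.symm⟩
  have : Finite {x : G | IsConj a x} := (hfin a).to_subtype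
  choose b hb using fun x : {x : G | IsConj a x} => isConj_iff.1 x.2
  -- `U` centralizes the chosen conjugators of `a`, so `u * a` has all `u * x` as conjugates;
  -- maximality of the class of `a` leaves no others.
  let U : Subgroup G := ⨅ x, Subgroup.centralizer ({b x} : Set G)
  have hU : U.FiniteIndex :=
    Subgroup.finiteIndex_iInf fun x => finiteIndex_centralizer_of_finite_conj (hfin (b x))
  let F : Set G := Set.image2 (fun x y => x * y⁻¹) {x | IsConj a x} {x | IsConj a x}
  have hF : F.Finite := (hfin a).image2 _ (hfin a)
  have translate : ∀ u ∈ U, (fun x => u * x) '' {x | IsConj a x} = {x | IsConj (u * a) x} := by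
    intro u hu
    refine Set.eq_of_subset_of_ncard_le ?_ ?_ (hfin _)
    · rintro _ ⟨x, hx, rfl⟩
      refine isConj_iff.2 ⟨b ⟨x, hx⟩, ?_⟩
      have h1 := hb ⟨x, hx⟩
      have h2 := Subgroup.mem_centralizer_singleton_iff.1 (Subgroup.mem_iInf.1 hu ⟨x, hx⟩)
      dsimp only at h1 ⊢
      rw [← mul_assoc, ← h2, mul_assoc, mul_assoc, ← mul_assoc (b _), h1]
    · rw [Set.ncard_image_of_injective _ (mul_right_injective u)]
      exact ha _
  have key : ∀ u ∈ U, ∀ g : G, ⁅u, g⁆ ∈ F := by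
    intro u hu g
    have hmem : g * (u⁻¹ * a) * g⁻¹ ∈ {x | IsConj (u⁻¹ * a) x} := isConj_iff.2 ⟨g, rfl⟩
    rw [← translate _ (inv_mem hu)] at hmem
    obtain ⟨x, hx, hxe⟩ := hmem
    refine ⟨x, hx, g * a * g⁻¹, isConj_iff.2 ⟨g, rfl⟩, ?_⟩
    have hx' : x = u * (g * (u⁻¹ * a) * g⁻¹) := by rw [← hxe]; simp
    simp only [hx', commutatorElement_def]
    group
  have hfinU : Finite (G ⧸ U) := inferInstance
  -- With `x = t * u`, `t` a coset representative: `⁅x, g⁆ = t * ⁅u, g⁆ * t⁻¹ * ⁅t, g⁆`, and `⁅t,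
  -- g⁆` depends only on `t` and `g * t * g⁻¹`.
  refine (Set.finite_iUnion fun q : G ⧸ U => hF.image2
    (fun f y => q.out * f * q.out⁻¹ * (q.out * y⁻¹)) (hfin q.out)).subset ?_
  rintro _ ⟨x, g, rfl⟩
  refine Set.mem_iUnion.2 ⟨(x : G ⧸ U), ⁅(x : G ⧸ U).out⁻¹ * x, g⁆, key _ ?_ g,
    g * (x : G ⧸ U).out * g⁻¹, isConj_iff.2 ⟨g, rfl⟩, ?_⟩
  · exact QuotientGroup.eq.1 (QuotientGroup.out_eq' _)
  · simp only [commutatorElement_def]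
    group

end ConjugacyClasses

section AutOrbits

variable {G : Type*} [Group G]

/-- A positive integer parameter, needed only up to multiples, can be chosen uniformly in a
group with finitely many automorphism orbits. -/
theorem HasFinitelyManyAutOrbits.exists_uniform (h : HasFinitelyManyAutOrbits G)
    (P : ℕ → G → Prop) (hinv : ∀ (f : MulAut G) n g, P n g → P n (f g))
    (hdvd : ∀ m n g, m ∣ n → P m g → P n g) (hex : ∀ g, ∃ n, 0 < n ∧ P n g) :
    ∃ n, 0 < n ∧ ∀ g, P n g := by
  have : Finite (MulAction.orbitRel.Quotient (MulAut G) G) := h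
  have := Fintype.ofFinite (MulAction.orbitRel.Quotient (MulAut G) G)
  choose k hk hP using hex
  refine ⟨∏ q : MulAction.orbitRel.Quotient (MulAut G) G, k q.out,
    Finset.prod_pos fun q _ => hk _, fun g => ?_⟩
  let q : MulAction.orbitRel.Quotient (MulAut G) G := Quotient.mk'' g
  have hq : g ∈ MulAction.orbit (MulAut G) q.out := by
    rw [← MulAction.orbitRel_apply]
    exact Quotient.exact (Quotient.out_eq q).symm
  obtain ⟨f, hf⟩ := hq
  have hf : f q.out = g := hf
  rw [← hf]
  exact hinv _ _ _ (hdvd _ _ _ (Finset.dvd_prod_of_mem (fun q => k q.out) (Finset.mem_univ q)) (hP _))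

theorem MulEquiv.apply_mem_center (f : MulAut G) {z : G} (hz : z ∈ Subgroup.center G) :
    f z ∈ Subgroup.center G := by
  rw [Subgroup.mem_center_iff] at hz ⊢
  intro g
  obtain ⟨g, rfl⟩ := f.surjective g
  rw [← map_mul, hz, map_mul]

theorem IsFCGroup.finite_commutator (hFC : IsFCGroup G) (h : HasFinitelyManyAutOrbits G) :
    Finite (commutator G) := by
  obtain ⟨N, hN, hb⟩ := h.exists_uniform (fun n g => {x : G | IsConj g x}.ncard ∣ n)
    (fun f n g hg => by
      have : {x : G | IsConj (f g) x} = f '' {x : G | IsConj g x} := by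
        ext x
        obtain ⟨x, rfl⟩ := f.surjective x
        simp only [Set.mem_ofPred_eq, f.injective.mem_set_image, isConj_iff]
        constructor
        · rintro ⟨c, hc⟩
          obtain ⟨c, rfl⟩ := f.surjective c
          exact ⟨c, f.injective (by simpa using hc)⟩
        · rintro ⟨c, rfl⟩
          exact ⟨f c, by simp⟩
      rw [this, Set.ncard_image_of_injective _ f.injective]
      exact hg)
    (fun m n g hmn hg => hg.trans hmn)
    (fun g => ⟨_, (Set.ncard_pos (hFC g)).2 ⟨g, IsConj.refl g⟩, dvd_rfl⟩)
  have := (finite_commutatorSet_of_bounded_conj hFC N fun g => Nat.le_of_dvd hN (hb g)).to_subtype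
  infer_instance

theorem IsFCGroup.exists_pow_mem_center (hFC : IsFCGroup G) (h : HasFinitelyManyAutOrbits G) :
    ∃ n, 0 < n ∧ ∀ g : G, g ^ n ∈ Subgroup.center G := by
  -- The uniformity is over the element `x` commuting with powers, not over the base `g`.
  obtain ⟨n, hn, hc⟩ := h.exists_uniform (fun n x => ∀ g : G, Commute x (g ^ n))
    (fun f n x hx g => by
      obtain ⟨g, rfl⟩ := f.surjective g
      rw [← map_pow]
      exact (hx g).map f)
    (fun m n x hmn hx g => by
      obtain ⟨k, rfl⟩ := hmn
      rw [pow_mul]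
      exact (hx g).pow_right k)
    (fun x => by
      have := finiteIndex_centralizer_of_finite_conj (hFC x)
      refine ⟨_, Nat.factorial_pos (Subgroup.centralizer ({x} : Set G)).index, fun g => ?_⟩
      obtain ⟨k, hk, hle, hmem⟩ := Subgroup.exists_pow_mem_of_index_ne_zero this.index_ne_zero g
      obtain ⟨l, hl⟩ := Nat.dvd_factorial hk hle
      rw [hl, pow_mul]
      have hcomm : Commute (g ^ k) x := Subgroup.mem_centralizer_singleton_iff.1 hmem
      exact hcomm.symm.pow_right l)
  exact ⟨n, hn, fun g => Subgroup.mem_center_iff.2 fun x => hc x g⟩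

theorem HasFinitelyManyAutOrbits.exists_torsion_exponent (h : HasFinitelyManyAutOrbits G) :
    ∃ n, 0 < n ∧ ∀ g : G, IsOfFinOrder g → g ^ n = 1 := by
  refine h.exists_uniform (fun n g => IsOfFinOrder g → g ^ n = 1) ?_ ?_ ?_
  · intro f n g hg hfg
    rw [← map_pow, hg ((Function.Injective.isOfFinOrder_iff (f := MulEquiv.toMonoidHom f) f.injective).1 hfg), map_one]
  · rintro m _ g ⟨k, rfl⟩ hg hfin
    rw [pow_mul, hg hfin, one_pow]
  · intro g
    by_cases hg : IsOfFinOrder g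
    · exact ⟨orderOf g, hg.orderOf_pos, fun _ => pow_orderOf_eq_one g⟩
    · exact ⟨1, one_pos, fun hg' => absurd hg' hg⟩

/-- Some power of the centre consists of elements that are infinitely divisible in the centre. -/
theorem HasFinitelyManyAutOrbits.exists_pow_divisible (h : HasFinitelyManyAutOrbits G) :
    ∃ N, 0 < N ∧ ∀ z ∈ Subgroup.center G, ∀ k, 0 < k →
      ∃ w ∈ Subgroup.center G, w ^ k = z ^ N := by
  obtain ⟨N, hN, hP⟩ := h.exists_uniform
    (fun n g => (∃ z ∈ Subgroup.center G, z ^ n = g) →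
      ∀ k, 0 < k → ∃ w ∈ Subgroup.center G, w ^ k = g)
    (by
      rintro f n g hg ⟨z, hz, hzg⟩ k hk
      obtain ⟨w, hw, rfl⟩ := hg ⟨f⁻¹ z, MulEquiv.apply_mem_center _ hz,
        f.injective (by simpa using hzg)⟩ k hk
      exact ⟨f w, MulEquiv.apply_mem_center f hw, (map_pow f w k).symm⟩)
    (by
      rintro m _ g ⟨l, rfl⟩ hg ⟨z, hz, hzg⟩
      exact hg ⟨z ^ l, pow_mem hz l, by rw [← pow_mul, mul_comm, hzg]⟩)
    (by
      intro g
      by_cases hg : ∀ k, 0 < k → ∃ w ∈ Subgroup.center G, w ^ k = g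
      · exact ⟨1, one_pos, fun _ => hg⟩
      · push Not at hg
        obtain ⟨k, hk, hw⟩ := hg
        -- A missing `k`-th root makes the condition for `n = k` vacuous.
        exact ⟨k, hk, fun ⟨z, hz, hzg⟩ => absurd hzg (hw z hz)⟩)
  exact ⟨N, hN, fun z hz => hP _ ⟨z, hz, rfl⟩⟩

end AutOrbits

/-- The torsion subgroup of a group with finite derived subgroup. -/
def torsionOfFiniteCommutator (G : Type*) [Group G] [Finite (commutator G)] : Subgroup G where
  carrier := {g | IsOfFinOrder g}
  one_mem' := IsOfFinOrder.one
  inv_mem' := fun h => h.inv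
  mul_mem' := by
    intro x y hx hy
    have hx' := (Abelianization.of : G →* _).isOfFinOrder hx
    have hy' := (Abelianization.of : G →* _).isOfFinOrder hy
    -- A power of `x * y` dies in the abelianization, so it lies in the finite `G'`.
    obtain ⟨n, hn, hxy⟩ := isOfFinOrder_iff_pow_eq_one.1 (hx'.mul hy')
    rw [← map_mul, ← map_pow, ← MonoidHom.mem_ker, Abelianization.ker_of] at hxy
    exact IsOfFinOrder.of_pow
      ((commutator G).subtype.isOfFinOrder (isOfFinOrder_of_finite ⟨_, hxy⟩)) hn.ne'

open scoped IsMulCommutative in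
/-- The subgroup of `N`-th powers of elements of the centre. -/
def centerPow (G : Type*) [Group G] (N : ℕ) : Subgroup (Subgroup.center G) :=
  (powMonoidHom N : Subgroup.center G →* Subgroup.center G).range

theorem mem_map_centerPow {G : Type*} [Group G] {N : ℕ} {g : G} :
    g ∈ (centerPow G N).map (Subgroup.center G).subtype ↔
      ∃ z ∈ Subgroup.center G, z ^ N = g := by
  constructor
  · rintro ⟨_, ⟨z, rfl⟩, rfl⟩
    exact ⟨z, z.2, rfl⟩
  · rintro ⟨z, hz, rfl⟩
    exact ⟨_, ⟨⟨z, hz⟩, rfl⟩, rfl⟩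

theorem theoremA {G : Type*} [Group G] (hFC : IsFCGroup G)
    (horb : HasFinitelyManyAutOrbits G) :
    Finite (commutator G) ∧
      ∃ T D : Subgroup G,
        (T : Set G) = {g : G | IsOfFinOrder g} ∧
        D ≤ Subgroup.center G ∧
        (D.subgroupOf (Subgroup.center G)).Characteristic ∧
        IsDivisibleGroup D ∧
        IsInternalDirectProduct T D := by
  have hfin := hFC.finite_commutator horb
  obtain ⟨m, hm, hcenter⟩ := hFC.exists_pow_mem_center horb
  obtain ⟨e, he, htors⟩ := horb.exists_torsion_exponent
  obtain ⟨N, hN, hdiv⟩ := horb.exists_pow_divisible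
  let D : Subgroup G := (centerPow G N).map (Subgroup.center G).subtype
  have hmem : ∀ g, g ∈ D ↔ ∃ z ∈ Subgroup.center G, z ^ N = g := fun g => mem_map_centerPow
  have hDZ : D ≤ Subgroup.center G := Subgroup.map_subtype_le _
  have hroot : ∀ k, 0 < k → ∀ d ∈ D, ∃ c ∈ D, c ^ k = d := by
    intro k hk d hd
    obtain ⟨z, hz, rfl⟩ := (hmem d).1 hd
    -- The extra factor `N` puts the `k`-th root `w ^ N` back in `D`.
    obtain ⟨w, hw, hwz⟩ := hdiv z hz (N * k) (Nat.mul_pos hN hk)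
    exact ⟨w ^ N, (hmem _).2 ⟨w, hw, rfl⟩, by rw [← pow_mul, hwz]⟩
  refine ⟨hfin, torsionOfFiniteCommutator G, D, rfl, hDZ, ?_, ?_, ?_, ?_, ?_, ?_⟩
  · have hDE : D.subgroupOf (Subgroup.center G) = centerPow G N :=
      Subgroup.comap_map_eq_self_of_injective (Subgroup.subtype_injective _) _
    rw [hDE, Subgroup.characteristic_iff_le_comap]
    rintro f _ ⟨z, rfl⟩
    exact ⟨f z, (map_pow f z N).symm⟩
  · rintro k hk ⟨d, hd⟩
    obtain ⟨c, hc, hcd⟩ := hroot k hk d hd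
    exact ⟨⟨c, hc⟩, Subtype.ext hcd⟩
  · exact ⟨fun x hx g => MonoidHom.isOfFinOrder (MulEquiv.toMonoidHom (MulAut.conj g)) hx⟩
  · refine ⟨fun x hx g => ?_⟩
    rw [Subgroup.mem_center_iff.1 (hDZ hx) g, mul_inv_cancel_right]
    exact hx
  · refine (Subgroup.eq_bot_iff_forall _).2 fun d hd => ?_
    obtain ⟨hdT, hdD⟩ := Subgroup.mem_inf.1 hd
    -- A root of a torsion element is torsion, so its `e`-th power is trivial.
    obtain ⟨c, -, rfl⟩ := hroot e he d hdD
    exact htors c (IsOfFinOrder.of_pow hdT he.ne')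
  · refine eq_top_iff.2 fun g _ => ?_
    have hg : (g ^ m) ^ N ∈ D := (hmem _).2 ⟨_, hcenter g, rfl⟩
    obtain ⟨c, hc, hcg⟩ := hroot (m * N) (Nat.mul_pos hm hN) _ hg
    have hcomm : Commute g c := Subgroup.mem_center_iff.1 (hDZ hc) g
    have htor : g * c⁻¹ ∈ torsionOfFiniteCommutator G := by
      refine isOfFinOrder_iff_pow_eq_one.2 ⟨m * N, Nat.mul_pos hm hN, ?_⟩
      rw [hcomm.inv_right.mul_pow, inv_pow, hcg, pow_mul, mul_inv_cancel]
    simpa using Subgroup.mul_mem_sup htor hc
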